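/- Let $a,b\ge 2$ be integers and $n=a+b-2$. The 2-connected $(a,b)$-puzzle has vertex set $\{1,\dots,n\}$ and two distinguished cycles, $\alpha=(1\ 2\ \dots\ a)$ and $\beta=(a-1\ a\ a+1\ \dots\ n)$, of lengths $a$ and $b$, which share the two consecutive vertices $a-1$ and $a$. A token placement is a permutation $f$ of $\{1,\dots,n\}$, where $f(v)$ is the token on vertex $v$. A shift moves every token on one of the two cycles to the next vertex along that cycle, or every token on it to the previous vertex, and leaves all other tokens in place; that is, it replaces $f$ by $f\circ g$ with $g\in\{\alpha,\alpha^{-1},\beta,\beta^{-1}\}$. The configuration group is the group of all permutations that can be obtained from the identity placement by a finite sequence of shifts. Then the configuration group of the 2-connected $(a,b)$-puzzle is 1. isomorphic to $S_{n-1}=S_5$ if $a=b=4$; 2. equal to the alternating group $A_n$ if $a$ and $b$ are both odd; 3. equal to the symmetric group $S_n$ in all other cases. Moreover, any permutation in the configuration group can be generated in $O(n^2)$ shifts: there is an absolute constant $K$ such that, for all $a,b\ge 2$, every permutation in the configuration group of the 2-connected $(a,b)$-puzzle is obtained from the identity placement by a sequence of at most $K n^2$ shifts. -/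

import Mathlib

namespace CyclicShift

variable {V : Type*} [DecidableEq V]

/-- A token placement `f : Equiv.Perm V` puts the token `f v` on the vertex `v` (the tokens are
pairwise distinct and labelled by the vertices). A cycle is given by the list `c = [v₁, …, vⱼ]` of
its consecutive vertices; `c.formPerm` sends each `vᵢ` to `vᵢ₊₁`, `vⱼ` to `v₁`, and fixes all other
vertices. `IsShift c f f'` says that `f'` is obtained from `f` by moving every token on the cycle
to the next vertex, or every token on the cycle to the previous vertex, and no other token. -/
def IsShift (c : List V) (f f' : Equiv.Perm V) : Prop :=
  (∀ v, f' (c.formPerm v) = f v) ∨ (∀ v, f' v = f (c.formPerm v))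

lemma IsShift.symm {c : List V} {f f' : Equiv.Perm V} (h : IsShift c f f') : IsShift c f' f :=
  h.elim (fun h => Or.inr fun v => (h v).symm) (fun h => Or.inl fun v => (h v).symm)

lemma IsShift.mul_left {c : List V} {f f' : Equiv.Perm V} (h : IsShift c f f')
    (g : Equiv.Perm V) : IsShift c (g * f) (g * f') :=
  h.elim (fun h => Or.inl fun v => congrArg g (h v)) (fun h => Or.inr fun v => congrArg g (h v))

/-- The token-shifting graph of the cycle set `C`: its vertices are the token placements, and two
distinct placements are adjacent if one is obtained from the other by one shift along a cycle
of `C`. -/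
def tokenShiftingGraph (C : Set (List V)) : SimpleGraph (Equiv.Perm V) where
  Adj f f' := f ≠ f' ∧ ∃ c ∈ C, IsShift c f f'
  symm := ⟨fun _ _ h => ⟨h.1.symm, h.2.imp fun _ hc => ⟨hc.1, hc.2.symm⟩⟩⟩
  loopless := ⟨fun _ h => h.1 rfl⟩

/-- Left multiplication (a relabelling of the tokens) preserves the token-shifting graph. -/
def mulLeftHom (C : Set (List V)) (g : Equiv.Perm V) :
    tokenShiftingGraph C →g tokenShiftingGraph C where
  toFun f := g * f
  map_rel' h := ⟨fun e => h.1 (mul_left_cancel e), h.2.imp fun _ hc => ⟨hc.1, hc.2.mul_left g⟩⟩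

/-- The configuration group generated by the cycle set `C`: all token placements that can be
reached by a sequence of shifts along cycles of `C` from the identity placement. -/
def configurationGroup (C : Set (List V)) : Subgroup (Equiv.Perm V) where
  carrier := {π | (tokenShiftingGraph C).Reachable 1 π}
  one_mem' := SimpleGraph.Reachable.refl 1
  mul_mem' := by
    intro σ τ hσ hτ
    have h := SimpleGraph.Reachable.map (mulLeftHom C σ) hτ
    have e : mulLeftHom C σ 1 = σ := mul_one σ
    rw [e] at h
    exact SimpleGraph.Reachable.trans hσ h
  inv_mem' := by
    intro σ hσ
    have h := SimpleGraph.Reachable.map (mulLeftHom C σ⁻¹) hσ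
    have e : mulLeftHom C σ⁻¹ 1 = σ⁻¹ := mul_one σ⁻¹
    have e' : mulLeftHom C σ⁻¹ σ = 1 := inv_mul_cancel σ
    rw [e, e'] at h
    exact h.symm

/-- The cycle set of the 2-connected `(a, b)`-puzzle (for `2 ≤ a`, `2 ≤ b`) on the `n = a + b - 2`
vertices `0, 1, …, n - 1`: the cycle `(0 1 … a-1)` of length `a` and the cycle `(a-2 a-1 … n-1)`
of length `b`, sharing the two consecutive vertices `a-2` and `a-1`. -/
def twoConnectedCycles (a b : ℕ) : Set (List (Fin (a + b - 2))) :=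
  {(List.finRange (a + b - 2)).take a, (List.finRange (a + b - 2)).drop (a - 2)}

end CyclicShift

/-! Shifts are right multiplications, so the group is generated by the two cycles α (`initialCycle`)
and β (`finalCycle`), and walk length is bounded by word length. The rotation c = αβ⁻¹ fixes the
shared vertex q = a - 1 and permutes all other vertices in one cycle.

Suppose a 3-cycle (q z)(q c(z)) is a word of bounded length. Its conjugates by powers of c telescope
to (q z)(q x), and in the product the powers of c nearly cancel, so every (q z)(q x) costs only O(n)
(`wordLe_swap_mul_swap`). An even permutation is a product of an even number, at most 3n, of star
transpositions (q x); pairing them through (q z) gives O(n²). An odd permutation needs one further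
odd generator, which exists unless a and b are both odd.

By reflection b ≤ a may be assumed. For b = 2, 3 the short 3-cycle comes directly from β. For a ≥ 6
and b ≥ 4 it is extracted from the commutator of β and α, a double transposition. The cases (5,4)
and (5,5) have explicit words. In the exceptional case (4,4), both cycles preserve a 1-factorization
of the complete graph on the six vertices, and the faithful action on its five matchings is all of
S₅. -/

namespace CyclicShift

/-! ### Word length in a group -/

section WordLe

variable {G : Type*} [Group G] {S : Set G}

/-- `g` is a product of at most `L` elements of `S` and inverses of elements of `S`. -/
def WordLe (S : Set G) (L : ℕ) (g : G) : Prop :=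
  ∃ l : List G, l.length ≤ L ∧ (∀ x ∈ l, x ∈ S ∨ x⁻¹ ∈ S) ∧ l.prod = g

lemma WordLe.mono {L L' : ℕ} {g : G} (h : WordLe S L g) (hL : L ≤ L') : WordLe S L' g :=
  let ⟨l, h1, h2⟩ := h
  ⟨l, h1.trans hL, h2⟩

lemma WordLe.one (L : ℕ) : WordLe S L (1 : G) := ⟨[], by simp, by simp, rfl⟩

lemma WordLe.of_mem {g : G} (h : g ∈ S) : WordLe S 1 g := ⟨[g], by simp, by simp [h], by simp⟩

lemma WordLe.mul {L M : ℕ} {g h : G} (hg : WordLe S L g) (hh : WordLe S M h) :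
    WordLe S (L + M) (g * h) := by
  obtain ⟨l, h1, h2, rfl⟩ := hg
  obtain ⟨m, h3, h4, rfl⟩ := hh
  refine ⟨l ++ m, by simp; omega, fun x hx => ?_, by simp⟩
  rcases List.mem_append.1 hx with hx | hx
  · exact h2 x hx
  · exact h4 x hx

lemma WordLe.inv {L : ℕ} {g : G} (hg : WordLe S L g) : WordLe S L g⁻¹ := by
  obtain ⟨l, h1, h2, rfl⟩ := hg
  refine ⟨(l.map (·⁻¹)).reverse, by simpa using h1, fun x hx => ?_, (List.prod_inv_reverse l).symm⟩
  obtain ⟨y, hy, rfl⟩ := List.mem_map.1 (List.mem_reverse.1 hx)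
  simpa [or_comm] using h2 y hy

lemma WordLe.pow {L : ℕ} {g : G} (hg : WordLe S L g) (k : ℕ) : WordLe S (k * L) (g ^ k) := by
  induction k with
  | zero => simpa using WordLe.one 0
  | succ k ih => rw [pow_succ, Nat.succ_mul]; exact ih.mul hg

lemma WordLe.conj {L M : ℕ} {g h : G} (hg : WordLe S L g) (hh : WordLe S M h) :
    WordLe S (M + L + M) (h * g * h⁻¹) := (hh.mul hg).mul hh.inv

lemma WordLe.map {H : Type*} [Group H] (φ : G →* H) {T : Set H} {L : ℕ} {g : G}
    (hST : ∀ s ∈ S, φ s ∈ T ∨ (φ s)⁻¹ ∈ T) (hg : WordLe S L g) : WordLe T L (φ g) := by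
  obtain ⟨l, h1, h2, rfl⟩ := hg
  refine ⟨l.map φ, by simpa using h1, fun x hx => ?_, (map_list_prod φ l).symm⟩
  obtain ⟨y, hy, rfl⟩ := List.mem_map.1 hx
  rcases h2 y hy with h | h
  · exact hST y h
  · simpa [or_comm] using hST _ h

lemma WordLe.mem_closure {L : ℕ} {g : G} (hg : WordLe S L g) : g ∈ Subgroup.closure S := by
  obtain ⟨l, -, h2, rfl⟩ := hg
  refine Subgroup.list_prod_mem _ fun x hx => ?_
  rcases h2 x hx with h | h
  · exact Subgroup.subset_closure h
  · exact inv_mem_iff.1 (Subgroup.subset_closure h)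

lemma exists_wordLe_of_mem_closure {g : G} (hg : g ∈ Subgroup.closure S) : ∃ L, WordLe S L g := by
  induction hg using Subgroup.closure_induction with
  | mem x hx => exact ⟨1, .of_mem hx⟩
  | one => exact ⟨0, .one 0⟩
  | mul x y _ _ hx hy =>
    obtain ⟨L, hL⟩ := hx
    obtain ⟨M, hM⟩ := hy
    exact ⟨_, hL.mul hM⟩
  | inv x _ hx =>
    obtain ⟨L, hL⟩ := hx
    exact ⟨L, hL.inv⟩

/-- In a finite group the word lengths of the elements of `closure S` are bounded. -/
lemma exists_forall_wordLe [Finite G] (S : Set G) :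
    ∃ L, ∀ g ∈ Subgroup.closure S, WordLe S L g := by
  have := Fintype.ofFinite G
  choose f hf using fun g : Subgroup.closure S => exists_wordLe_of_mem_closure g.2
  classical
  have := Fintype.ofFinite (Subgroup.closure S)
  exact ⟨Finset.univ.sup f, fun g hg =>
    (hf ⟨g, hg⟩).mono (Finset.le_sup (f := f) (Finset.mem_univ _))⟩

end WordLe

/-! ### Walks of shifts as words in the cycles -/

section Walks

variable {V : Type*} [DecidableEq V] {C : Set (List V)}

lemma isShift_one_iff {c : List V} {g : Equiv.Perm V} :
    IsShift c 1 g ↔ g = c.formPerm⁻¹ ∨ g = c.formPerm := by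
  refine or_congr ⟨fun h => ?_, ?_⟩ ⟨fun h => Equiv.ext h, ?_⟩
  · exact eq_inv_of_mul_eq_one_left (Equiv.ext h)
  · rintro rfl v
    simp
  · rintro rfl v
    rfl

/-- The bound is not an equality because a list with trivial `formPerm` moves no token and the graph
has no loops. -/
lemma exists_walk_of_isShift {c : List V} (hc : c ∈ C) {f f' : Equiv.Perm V}
    (h : IsShift c f f') : ∃ w : (tokenShiftingGraph C).Walk f f', w.length ≤ 1 := by
  by_cases e : f = f'
  · subst e
    exact ⟨.nil, by simp⟩
  · exact ⟨SimpleGraph.Walk.cons (show (tokenShiftingGraph C).Adj f f' from ⟨e, c, hc, h⟩) .nil,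
      by simp⟩

lemma exists_walk_of_wordLe {L : ℕ} {g : Equiv.Perm V}
    (hg : WordLe (List.formPerm '' C) L g) :
    ∃ w : (tokenShiftingGraph C).Walk 1 g, w.length ≤ L := by
  obtain ⟨l, h1, h2, rfl⟩ := hg
  suffices h : ∀ f g : Equiv.Perm V, f * l.prod = g →
      ∃ w : (tokenShiftingGraph C).Walk f g, w.length ≤ l.length by
    obtain ⟨w, hw⟩ := h 1 _ (one_mul _)
    exact ⟨w, hw.trans h1⟩
  clear h1
  induction l with
  | nil =>
    rintro f g rfl
    rw [List.prod_nil, mul_one]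
    exact ⟨.nil, le_rfl⟩
  | cons x l ih =>
    intro f g hg
    obtain ⟨w, hw⟩ := ih (fun y hy => h2 y (List.mem_cons_of_mem _ hy)) (f * x) g
      (by rw [← hg, List.prod_cons, mul_assoc])
    have hx : ∃ c ∈ C, IsShift c 1 x := by
      rcases h2 x (by simp) with ⟨c, hc, e⟩ | ⟨c, hc, e⟩
      · exact ⟨c, hc, isShift_one_iff.2 (.inr e.symm)⟩
      · exact ⟨c, hc, isShift_one_iff.2 (.inl (by rw [e, inv_inv]))⟩
    obtain ⟨c, hc, hs⟩ := hx
    have hs' := hs.mul_left f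
    rw [mul_one] at hs'
    obtain ⟨w', hw'⟩ := exists_walk_of_isShift hc hs'
    refine ⟨w'.append w, ?_⟩
    rw [SimpleGraph.Walk.length_append, List.length_cons]
    omega

theorem configurationGroup_eq_closure (C : Set (List V)) :
    configurationGroup C = Subgroup.closure (List.formPerm '' C) := by
  refine le_antisymm ?_ ?_
  · rintro g ⟨w⟩
    suffices h : ∀ f g : Equiv.Perm V, (tokenShiftingGraph C).Walk f g →
        f⁻¹ * g ∈ Subgroup.closure (List.formPerm '' C) by simpa using h 1 g w
    intro f g w
    induction w with
    | nil => simp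
    | @cons f f' g h _ ih =>
      obtain ⟨-, c, hc, hs⟩ := h
      have hs' := hs.mul_left f⁻¹
      rw [inv_mul_cancel, isShift_one_iff] at hs'
      have hm : f⁻¹ * f' ∈ Subgroup.closure (List.formPerm '' C) := by
        have hc' : c.formPerm ∈ Subgroup.closure (List.formPerm '' C) :=
          Subgroup.subset_closure ⟨c, hc, rfl⟩
        rcases hs' with e | e <;> rw [e]
        · exact inv_mem hc'
        · exact hc'
      simpa [mul_assoc] using mul_mem hm ih
  · rw [Subgroup.closure_le]
    rintro _ ⟨c, hc, rfl⟩
    obtain ⟨w, -⟩ := exists_walk_of_isShift hc (isShift_one_iff.2 (.inr rfl))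
    exact ⟨w⟩

end Walks

/-! ### Even permutations from star transpositions -/

section Star

open Equiv

variable {V : Type*} [DecidableEq V] {S : Set (Perm V)} {q z : V} {c : Perm V} {L : ℕ}

/-- Products of the conjugates of `(q z)(q c(z))` by powers of a permutation `c` fixing `q`
telescope. -/
lemma swap_mul_swap_mul_pow (hq : c q = q) (m : ℕ) :
    (swap q z * swap q (c z) * c) ^ m = swap q z * swap q ((c ^ m) z) * c ^ m := by
  induction m with
  | zero => simp
  | succ m ih =>
    have hqm : (c ^ m) q = q := Perm.pow_apply_eq_self_of_apply_eq_self hq m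
    have h1 : ∀ x, c ^ m * swap q x = swap q ((c ^ m) x) * c ^ m := fun x => by
      rw [mul_swap_eq_swap_mul, hqm]
    calc (swap q z * swap q (c z) * c) ^ (m + 1)
        = swap q z * swap q ((c ^ m) z) * (c ^ m * swap q z) * swap q (c z) * c := by
          rw [pow_succ, ih]; simp only [mul_assoc]
      _ = swap q z * (swap q ((c ^ m) z) * swap q ((c ^ m) z)) * (c ^ m * swap q (c z)) * c := by
          rw [h1]; simp only [mul_assoc]
      _ = _ := by
          rw [h1, swap_mul_self, mul_one, ← Perm.mul_apply, ← pow_succ]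
          simp only [mul_assoc, pow_succ]

lemma wordLe_swap_mul_swap (hq : c q = q) {M N : ℕ} (hc : WordLe S M c)
    (hT : WordLe S L (swap q z * swap q (c z))) {x : V} (hx : ∃ m ≤ N, (c ^ m) z = x) :
    WordLe S (N * (L + 2 * M)) (swap q z * swap q x) := by
  obtain ⟨m, hm, rfl⟩ := hx
  -- The powers of c between successive 3-cycles cancel, so all m conjugates together cost m(L + M)
  -- + mM, linear in m.
  have h := (((hT.mul hc).pow m).mul (hc.pow m).inv)
  rw [swap_mul_swap_mul_pow hq, mul_inv_cancel_right] at h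
  refine h.mono ?_
  calc m * (L + M) + m * M = m * (L + 2 * M) := by ring
    _ ≤ _ := Nat.mul_le_mul_right _ hm

/-- Multiplying by (v π(v)) makes v fixed and shrinks the support; that transposition is a product
of at most three star transpositions. -/
lemma exists_star_factorization [Fintype V] (q : V) (π : Perm V) :
    ∃ l : List V, l.length ≤ 3 * π.support.card ∧ (∀ x ∈ l, x ≠ q) ∧
      (l.map (swap q)).prod = π := by
  induction hk : π.support.card using Nat.strong_induction_on generalizing π with
  | _ k ih =>
    subst hk
    by_cases h1 : π = 1
    · exact ⟨[], by simp, by simp, by simp [h1]⟩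
    · obtain ⟨v, hv⟩ : ∃ v, π v ≠ v := by
        by_contra! h
        exact h1 (Equiv.ext h)
      have hlt := Perm.card_support_swap_mul hv
      obtain ⟨l, hl, hlq, hlp⟩ := ih _ hlt _ rfl
      have hs : ∃ m : List V, m.length ≤ 3 ∧ (∀ x ∈ m, x ≠ q) ∧
          (m.map (swap q)).prod = swap v (π v) := by
        by_cases hvq : v = q
        · exact ⟨[π v], by simp, by rw [← hvq]; simpa using hv, by simp [hvq]⟩
        by_cases hwq : π v = q
        · exact ⟨[v], by simp, by simpa using hvq, by rw [hwq, swap_comm v q]; simp⟩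
        · refine ⟨[v, π v, v], by simp, by simp [hvq, hwq], ?_⟩
          simp only [List.map_cons, List.map_nil, List.prod_cons, List.prod_nil, mul_one]
          rw [← mul_assoc, swap_comm q (π v), swap_mul_swap_mul_swap hwq hv]
      obtain ⟨m, hm, hmq, hmp⟩ := hs
      refine ⟨m ++ l, ?_, ?_, ?_⟩
      · rw [List.length_append]; omega
      · intro x hx
        rcases List.mem_append.1 hx with hx | hx
        · exact hmq x hx
        · exact hlq x hx
      · rw [List.map_append, List.prod_append, hmp, hlp, swap_mul_self_mul]

/-- The two parities feed each other: (q x) is the inverse of (q z)(q x) times (q z), so each new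
factor either absorbs or creates a leading (q z). -/
lemma wordLe_star_prod {z : V} (h : ∀ x, x ≠ q → WordLe S L (swap q z * swap q x)) (l : List V)
    (hl : ∀ x ∈ l, x ≠ q) :
    (Even l.length → WordLe S (l.length * L) (l.map (swap q)).prod) ∧
      (Odd l.length → WordLe S (l.length * L) (swap q z * (l.map (swap q)).prod)) := by
  induction l with
  | nil => exact ⟨fun _ => .one _, fun h => by simp at h⟩
  | cons x l ih =>
    obtain ⟨ih1, ih2⟩ := ih fun y hy => hl y (List.mem_cons_of_mem _ hy)
    have hx := h x (hl x (by simp))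
    simp only [List.length_cons, List.map_cons, List.prod_cons, Nat.even_add_one, Nat.odd_add_one,
      Nat.not_even_iff_odd, Nat.not_odd_iff_even]
    rw [Nat.succ_mul, add_comm]
    refine ⟨fun ho => ?_, fun he => ?_⟩
    · have := hx.inv.mul (ih2 ho)
      simpa [mul_assoc] using this
    · have := hx.mul (ih1 he)
      simpa [mul_assoc] using this

theorem wordLe_of_sign_eq_one [Fintype V] {z : V}
    (h : ∀ x, x ≠ q → WordLe S L (swap q z * swap q x)) {π : Perm V} (hπ : Perm.sign π = 1) :
    WordLe S (3 * Fintype.card V * L) π := by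
  obtain ⟨l, hl, hlq, rfl⟩ := exists_star_factorization q π
  have he : Even l.length := by
    have hs : Perm.sign (l.map (swap q)).prod = (-1) ^ l.length := by
      rw [map_list_prod, List.map_map, List.prod_eq_pow_card _ (-1)]
      · simp
      · intro s hs
        obtain ⟨x, hx, rfl⟩ := List.mem_map.1 hs
        exact Perm.sign_swap (hlq x hx).symm
    rw [hs] at hπ
    by_contra ho
    rw [Nat.not_even_iff_odd] at ho
    rw [ho.neg_one_pow] at hπ
    exact absurd hπ (by decide)
  refine ((wordLe_star_prod h l hlq).1 he).mono (Nat.mul_le_mul_right _ (hl.trans ?_))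
  exact Nat.mul_le_mul_left _ (Finset.card_le_univ _)

end Star

/-! ### The two cycles, their reflection and the rotation -/

section Puzzle

open Equiv

/-- The cycle `(0 1 … a-1)` on `Fin n`. -/
def initialCycle (n a : ℕ) : Perm (Fin n) := ((List.finRange n).take a).formPerm

/-- The cycle `(k k+1 … n-1)` on `Fin n`. -/
def finalCycle (n k : ℕ) : Perm (Fin n) := ((List.finRange n).drop k).formPerm

/-- The two cycles of a 2-connected puzzle with `n` vertices whose first cycle has length `a`. -/
def puzzleGenerators (n a : ℕ) : Set (Perm (Fin n)) := {initialCycle n a, finalCycle n (a - 2)}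

lemma formPerm_image_twoConnectedCycles (a b : ℕ) :
    List.formPerm '' twoConnectedCycles a b = puzzleGenerators (a + b - 2) a :=
  Set.image_pair _ _ _

lemma val_initialCycle_apply {n a : ℕ} (han : a ≤ n) (v : Fin n) :
    (initialCycle n a v : ℕ) = if (v : ℕ) + 1 < a then (v : ℕ) + 1 else if (v : ℕ) < a then 0
      else v := by
  have hlen : ((List.finRange n).take a).length = a := by simp [han]
  have hnd : ((List.finRange n).take a).Nodup :=
    (List.nodup_finRange n).sublist (List.take_sublist _ _)
  by_cases hv : (v : ℕ) < a
  · have hget : ((List.finRange n).take a)[(v : ℕ)]'(by rw [hlen]; exact hv) = v := by simp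
    have h := List.formPerm_apply_getElem _ hnd v (by rw [hlen]; exact hv)
    rw [hget] at h
    rw [initialCycle, h]
    simp only [List.getElem_take, List.getElem_finRange, hlen, Fin.val_cast]
    split_ifs with h1
    · exact Nat.mod_eq_of_lt h1
    · rw [show (v : ℕ) + 1 = a by omega, Nat.mod_self]
  · rw [initialCycle, List.formPerm_apply_of_notMem, if_neg (by omega), if_neg hv]
    intro hm
    obtain ⟨i, hi, e⟩ := List.getElem_of_mem hm
    rw [hlen] at hi
    apply hv
    rw [← e]
    simpa using hi

lemma val_finalCycle_apply {n k : ℕ} (v : Fin n) :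
    (finalCycle n k v : ℕ) = if (v : ℕ) < k then (v : ℕ) else if (v : ℕ) + 1 < n then (v : ℕ) + 1
      else k := by
  have hlen : ((List.finRange n).drop k).length = n - k := by simp
  have hnd : ((List.finRange n).drop k).Nodup :=
    (List.nodup_finRange n).sublist (List.drop_sublist _ _)
  by_cases hv : (v : ℕ) < k
  · rw [finalCycle, List.formPerm_apply_of_notMem, if_pos hv]
    intro hm
    obtain ⟨i, hi, e⟩ := List.getElem_of_mem hm
    have : (v : ℕ) = k + i := by rw [← e]; simp
    omega
  · have hlt : (v : ℕ) - k < ((List.finRange n).drop k).length := by rw [hlen]; omega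
    have hget : ((List.finRange n).drop k)[(v : ℕ) - k]'hlt = v := by
      apply Fin.ext
      simp
      omega
    have h := List.formPerm_apply_getElem _ hnd _ hlt
    rw [hget] at h
    rw [finalCycle, h, if_neg hv]
    simp only [List.getElem_drop, List.getElem_finRange, hlen, Fin.val_cast]
    split_ifs with h1
    · rw [Nat.mod_eq_of_lt (by omega)]
      omega
    · rw [show (v : ℕ) - k + 1 = n - k by omega, Nat.mod_self, Nat.add_zero]

lemma revPerm_conj_finalCycle {n k : ℕ} (hk : k < n) :
    (Fin.revPerm * finalCycle n k * Fin.revPerm⁻¹)⁻¹ = initialCycle n (n - k) := by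
  rw [inv_eq_iff_mul_eq_one]
  ext v
  simp only [Perm.mul_apply, Perm.one_apply]
  have hinv : ∀ x : Fin n, (Fin.revPerm⁻¹ : Perm (Fin n)) x = x.rev := fun x => rfl
  rw [hinv, Fin.revPerm_apply, Fin.val_rev, val_finalCycle_apply, Fin.val_rev,
    val_initialCycle_apply (by omega)]
  have := v.2
  split_ifs <;> omega

lemma revPerm_conj_initialCycle {n a : ℕ} (ha : 1 ≤ a) (han : a ≤ n) :
    (Fin.revPerm * initialCycle n a * Fin.revPerm⁻¹)⁻¹ = finalCycle n (n - a) := by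
  have h := revPerm_conj_finalCycle (n := n) (k := n - a) (by omega)
  rw [Nat.sub_sub_self han] at h
  rw [← h]
  have hr : (Fin.revPerm : Perm (Fin n)) * Fin.revPerm = 1 := by
    ext v
    simp
  have hr' : (Fin.revPerm⁻¹ : Perm (Fin n)) = Fin.revPerm := inv_eq_of_mul_eq_one_right hr
  simp only [mul_inv_rev, inv_inv, hr', mul_assoc, hr, mul_one]

/-- The reflection v ↦ n - 1 - v exchanges the two cycles and reverses their direction. This is the
symmetry behind assuming b ≤ a. -/
lemma WordLe.revPerm_conj {n a b L : ℕ} (ha : 2 ≤ a) (hb : 2 ≤ b) (hab : a + b = n + 2)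
    {π : Perm (Fin n)} (h : WordLe (puzzleGenerators n a) L π) :
    WordLe (puzzleGenerators n b) L (Fin.revPerm * π * Fin.revPerm⁻¹) := by
  refine h.map (MulAut.conj (Fin.revPerm : Perm (Fin n))).toMonoidHom ?_
  rintro s (rfl | rfl) <;> right
  · right
    change (Fin.revPerm * initialCycle n a * Fin.revPerm⁻¹)⁻¹ = _
    rw [revPerm_conj_initialCycle (by omega) (by omega)]
    congr 1
    omega
  · left
    change (Fin.revPerm * finalCycle n (a - 2) * Fin.revPerm⁻¹)⁻¹ = _
    rw [revPerm_conj_finalCycle (by omega)]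
    congr 1
    omega

lemma sign_initialCycle {n a : ℕ} (ha : 2 ≤ a) (han : a ≤ n) :
    Perm.sign (initialCycle n a) = -(-1) ^ a := by
  have hlen : ((List.finRange n).take a).length = a := by simp [han]
  have hnd : ((List.finRange n).take a).Nodup :=
    (List.nodup_finRange n).sublist (List.take_sublist _ _)
  have hc := List.isCycle_formPerm hnd (by omega)
  rw [initialCycle, hc.sign, List.support_formPerm_of_nodup _ hnd, List.toFinset_card_of_nodup hnd,
    hlen]
  intro x hx
  rw [hx, List.length_singleton] at hlen
  omega

lemma sign_finalCycle {n k : ℕ} (hk : k + 2 ≤ n) :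
    Perm.sign (finalCycle n k) = -(-1) ^ (n - k) := by
  have h := congrArg Perm.sign (revPerm_conj_finalCycle (n := n) (k := k) (by omega))
  rw [sign_initialCycle (by omega) (by omega)] at h
  rw [← h, Perm.sign_inv, map_mul, map_mul, Perm.sign_inv, mul_right_comm, Int.units_mul_self,
    one_mul]

/-! ### The rotation fixing a shared vertex -/

/-- The product of the first cycle and the inverse of the second: it fixes the vertex `a - 1` and
permutes the others cyclically. -/
def rotation (n a : ℕ) : Perm (Fin n) := initialCycle n a * (finalCycle n (a - 2))⁻¹

lemma wordLe_initialCycle (n a : ℕ) : WordLe (puzzleGenerators n a) 1 (initialCycle n a) :=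
  .of_mem (Set.mem_insert _ _)

lemma wordLe_finalCycle (n a : ℕ) : WordLe (puzzleGenerators n a) 1 (finalCycle n (a - 2)) :=
  .of_mem (Set.mem_insert_of_mem _ rfl)

lemma wordLe_rotation (n a : ℕ) : WordLe (puzzleGenerators n a) 2 (rotation n a) :=
  (wordLe_initialCycle n a).mul (wordLe_finalCycle n a).inv

/-- The orbit runs 0, 1, …, a - 2, then n - 1, n - 2, …, a, and back to 0; for a = n it closes up
directly after a - 2. -/
lemma rotation_apply_eq {n a : ℕ} (ha : 2 ≤ a) (han : a ≤ n) (v w : Fin n)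
    (h : (w : ℕ) = if (v : ℕ) + 2 < a then (v : ℕ) + 1 else if (v : ℕ) + 2 = a then
      (if a = n then 0 else n - 1) else if (v : ℕ) + 1 = a then a - 1 else if (v : ℕ) = a then 0
      else v - 1) :
    rotation n a v = w := by
  -- Writing v as the image of u under β avoids a formula for the inverse cycle.
  obtain ⟨u, rfl⟩ := (finalCycle n (a - 2)).surjective v
  rw [rotation, ← Perm.mul_apply, inv_mul_cancel_right]
  apply Fin.ext
  rw [val_finalCycle_apply] at h
  rw [val_initialCycle_apply han, h]
  have := u.2
  split_ifs <;> omega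

lemma rotation_apply_self {n a : ℕ} (ha : 2 ≤ a) (han : a ≤ n) :
    rotation n a ⟨a - 1, by omega⟩ = ⟨a - 1, by omega⟩ := by
  apply rotation_apply_eq ha han
  dsimp only
  split_ifs <;> omega

lemma rotation_pow_zero_of_le {n a : ℕ} (ha : 2 ≤ a) (han : a ≤ n) (j : ℕ) (hj : j + 2 ≤ a) :
    (rotation n a ^ j) ⟨0, by omega⟩ = ⟨j, by omega⟩ := by
  induction j with
  | zero => rfl
  | succ j ih =>
    rw [pow_succ', Perm.mul_apply, ih (by omega)]
    apply rotation_apply_eq ha han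
    rw [if_pos (by dsimp only; omega)]

lemma rotation_pow_zero_of_ge {n a : ℕ} (ha : 2 ≤ a) (k : ℕ) (hk : a + k + 1 ≤ n) :
    (rotation n a ^ (a - 1 + k)) ⟨0, by omega⟩ = ⟨n - 1 - k, by omega⟩ := by
  have han : a ≤ n := by omega
  induction k with
  | zero =>
    rw [show a - 1 + 0 = a - 2 + 1 by omega, pow_succ', Perm.mul_apply,
      rotation_pow_zero_of_le ha han _ (by omega)]
    apply rotation_apply_eq ha han
    dsimp only
    split_ifs <;> omega
  | succ k ih =>
    rw [← add_assoc, pow_succ', Perm.mul_apply, ih (by omega)]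
    apply rotation_apply_eq ha han
    dsimp only
    split_ifs <;> omega

lemma exists_rotation_pow_zero_eq {n a : ℕ} (ha : 2 ≤ a) (han : a ≤ n) (x : Fin n)
    (hx : (x : ℕ) ≠ a - 1) :
    ∃ m ≤ n - 1, (rotation n a ^ m) ⟨0, by omega⟩ = x := by
  have := x.2
  by_cases hxa : (x : ℕ) + 2 ≤ a
  · exact ⟨x, by omega, rotation_pow_zero_of_le ha han x hxa⟩
  · refine ⟨a - 1 + (n - 1 - x), by omega, ?_⟩
    rw [rotation_pow_zero_of_ge ha _ (by omega)]
    apply Fin.ext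
    dsimp only
    omega

lemma rotation_pow_zero {n a : ℕ} (ha : 2 ≤ a) (han : a ≤ n) :
    (rotation n a ^ (n - 1)) ⟨0, by omega⟩ = ⟨0, by omega⟩ := by
  rw [show n - 1 = n - 2 + 1 by omega, pow_succ', Perm.mul_apply]
  obtain rfl | h := han.eq_or_lt
  · rw [rotation_pow_zero_of_le ha le_rfl _ (by omega)]
    apply rotation_apply_eq ha le_rfl
    dsimp only
    split_ifs <;> omega
  · rw [show n - 2 = a - 1 + (n - 1 - a) by omega, rotation_pow_zero_of_ge ha _ (by omega)]
    apply rotation_apply_eq ha han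
    dsimp only
    split_ifs <;> omega

lemma exists_rotation_pow_eq {n a : ℕ} (ha : 2 ≤ a) (han : a ≤ n) (z x : Fin n)
    (hz : (z : ℕ) ≠ a - 1) (hx : (x : ℕ) ≠ a - 1) :
    ∃ m ≤ 2 * n, (rotation n a ^ m) z = x := by
  obtain ⟨i, hi, rfl⟩ := exists_rotation_pow_zero_eq ha han z hz
  obtain ⟨j, hj, rfl⟩ := exists_rotation_pow_zero_eq ha han x hx
  -- Complete the turn from z to 0, which takes n - 1 - i steps, then go on to x in j steps.
  refine ⟨j + (n - 1 - i), by omega, ?_⟩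
  rw [← Perm.mul_apply, ← pow_add, add_assoc, Nat.sub_add_cancel hi, pow_add, Perm.mul_apply,
    rotation_pow_zero ha han]

/-- If some 3-cycle `(q z)(q c(z))`, where `c` is the rotation and `q` its fixed vertex, is a short
word, then every even permutation is a word of quadratic length. -/
theorem wordLe_of_sign_eq_one_of_swap_mul_swap {n a L : ℕ} (ha : 2 ≤ a) (han : a ≤ n) {q z : Fin n}
    (hq : (q : ℕ) = a - 1) (hz : z ≠ q)
    (hT : WordLe (puzzleGenerators n a) L (swap q z * swap q (rotation n a z)))
    {π : Perm (Fin n)} (hπ : Perm.sign π = 1) :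
    WordLe (puzzleGenerators n a) (6 * (L + 4) * n ^ 2) π := by
  have hq' : q = ⟨a - 1, by omega⟩ := Fin.ext hq
  rw [hq'] at hz hT
  have h := wordLe_of_sign_eq_one (fun x hx => wordLe_swap_mul_swap (rotation_apply_self ha han)
    (wordLe_rotation n a) hT (exists_rotation_pow_eq ha han z x (fun e => hz (Fin.ext e))
      (fun e => hx (Fin.ext e)))) hπ
  rw [Fintype.card_fin] at h
  exact h.mono (le_of_eq (by ring))

end Puzzle
-- From double transpositions to 3-cycles
section DoubleTransposition

open Equiv

variable {V : Type*} [DecidableEq V] {S : Set (Perm V)}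

lemma conj_swap_mul_swap (g : Perm V) (a b c d : V) :
    g * (swap a b * swap c d) * g⁻¹ = swap (g a) (g b) * swap (g c) (g d) := by
  rw [swap_apply_apply, swap_apply_apply]
  group

lemma swap_mul_swap_sq {s t y : V} (hst : s ≠ t) (hsy : s ≠ y) (hty : t ≠ y) :
    (swap s y * swap t y) ^ 2 = swap t y * swap s y := by
  have h1 : swap s y * swap t y * swap s y = swap s t := by
    rw [swap_comm s y, swap_mul_swap_mul_swap hty hst.symm]
  have h2 : swap t y * swap s y * swap t y = swap s t := by
    rw [swap_comm t y, swap_mul_swap_mul_swap hsy hst, swap_comm]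
  calc (swap s y * swap t y) ^ 2 = swap s y * swap t y * swap s y * swap t y := by
        rw [pow_two]; simp only [mul_assoc]
    _ = _ := by rw [h1, ← h2, mul_swap_mul_self]

lemma commute_swap_swap {a b c d : V} (hac : a ≠ c) (had : a ≠ d) (hbc : b ≠ c) (hbd : b ≠ d) :
    Commute (swap a b) (swap c d) := by
  rw [Commute, SemiconjBy, mul_swap_eq_swap_mul, swap_apply_of_ne_of_ne hac.symm hbc.symm,
    swap_apply_of_ne_of_ne had.symm hbd.symm]

/-- Two double transpositions that overlap in one point only yield a 3-cycle. -/
lemma WordLe.swap_mul_swap_of_double {u u' v v' s t y : V} (hnd : [u, u', v, v', s, t, y].Nodup)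
    {L M : ℕ} (h1 : WordLe S L (swap u u' * swap s y)) (h2 : WordLe S M (swap v v' * swap t y)) :
    WordLe S (2 * (L + M)) (swap t y * swap s y) := by
  simp only [List.nodup_cons, List.mem_cons, List.not_mem_nil, or_false, not_or, not_false_eq_true,
    List.nodup_nil, and_true] at hnd
  obtain ⟨⟨-, huv, huv', hus, hut, huy⟩, ⟨hu'v, hu'v', hu's, hu't, hu'y⟩, ⟨-, hvs, hvt, hvy⟩,
    ⟨hv's, hv't, hv'y⟩, ⟨hst, hsy⟩, hty⟩ := hnd
  have hvS : Commute (swap v v') (swap s y) := commute_swap_swap hvs hvy hv's hv'y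
  have hvT : Commute (swap v v') (swap t y) := commute_swap_swap hvt hvy hv't hv'y
  have huS : Commute (swap u u') (swap s y) := commute_swap_swap hus huy hu's hu'y
  have huT : Commute (swap u u') (swap t y) := commute_swap_swap hut huy hu't hu'y
  have huV : Commute (swap u u') (swap v v') := commute_swap_swap huv huv' hu'v hu'v'
  -- Squaring kills the outer transpositions, which commute with everything else, and turns the
  -- 3-cycle on s, t, y into its inverse.
  have h := (h1.mul h2).pow 2
  have e : swap u u' * swap s y * (swap v v' * swap t y) =
      swap u u' * swap v v' * (swap s y * swap t y) := by
    rw [mul_assoc, ← mul_assoc (swap s y), ← hvS.eq]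
    simp only [mul_assoc]
  rw [e, ((huS.mul_right huT).mul_left (hvS.mul_right hvT)).mul_pow, huV.mul_pow,
    pow_two (swap u u'), swap_mul_self, pow_two (swap v v'), swap_mul_self, one_mul, one_mul,
    swap_mul_swap_sq hst hsy hty] at h
  exact h

/-- Two 3-cycles that overlap in one point only yield a 3-cycle on `s, t` and a point of the other
3-cycle. -/
lemma WordLe.swap_mul_swap_of_swap_mul_swap {s t u v y : V} (hnd : [s, t, u, v, y].Nodup)
    {L M : ℕ} (h1 : WordLe S L (swap t y * swap s y)) (h2 : WordLe S M (swap v y * swap u y)) :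
    WordLe S (M + L + M) (swap s v * swap s t) := by
  simp only [List.nodup_cons, List.mem_cons, List.not_mem_nil, or_false, not_or, not_false_eq_true,
    List.nodup_nil, and_true] at hnd
  obtain ⟨⟨hst, hsu, hsv, hsy⟩, ⟨htu, htv, hty⟩, ⟨huv, huy⟩, hvy⟩ := hnd
  -- The inverse of the second 3-cycle fixes s and t and sends y to v.
  have h := h1.conj h2.inv
  have hap : ∀ x, x ≠ u → x ≠ v → x ≠ y → (swap v y * swap u y)⁻¹ x = x := fun x hu hv hy => by
    rw [mul_inv_rev, swap_inv, swap_inv, Perm.mul_apply, swap_apply_of_ne_of_ne hv hy,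
      swap_apply_of_ne_of_ne hu hy]
  have hy : (swap v y * swap u y)⁻¹ y = v := by
    rw [mul_inv_rev, swap_inv, swap_inv, Perm.mul_apply, swap_apply_right,
      swap_apply_of_ne_of_ne (Ne.symm huv) hvy]
  rw [conj_swap_mul_swap, hap t htu htv hty, hap s hsu hsv hsy, hy] at h
  have e : swap t v * swap s v = swap s v * swap s t := by
    rw [mul_swap_eq_swap_mul (swap s v), swap_apply_left, swap_apply_of_ne_of_ne (Ne.symm hst) htv,
      swap_comm v t]
  rwa [e] at h

lemma WordLe.conj_double {α : Perm V} {M L : ℕ} (hα : WordLe S M α) {u u' s y : V}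
    (hy : α y = y) (h : WordLe S L (swap u u' * swap s y)) :
    WordLe S (M + L + M) (swap (α u) (α u') * swap (α s) y) := by
  have h' := h.conj hα
  rwa [conj_swap_mul_swap, hy] at h'

end DoubleTransposition

/-! ### A short 3-cycle when a ≥ 6 -/

section ThreeCycles

open Equiv

lemma val_swap_apply {n : ℕ} (i j v : Fin n) :
    (swap i j v : ℕ) = if (v : ℕ) = i then (j : ℕ) else if (v : ℕ) = j then (i : ℕ) else v := by
  rw [swap_apply_def]
  simp only [Fin.ext_iff]
  split_ifs <;> rfl

/-- This computes the commutator βαβ⁻¹α⁻¹, without inverses so that it reduces to a case check on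
values. -/
lemma swap_mul_swap_mul_eq_finalCycle_mul_initialCycle {n a : ℕ} (ha : 3 ≤ a) (han : a < n) :
    finalCycle n (a - 2) * initialCycle n a =
      swap ⟨a - 2, by omega⟩ ⟨a - 1, by omega⟩ * swap ⟨0, by omega⟩ ⟨a, han⟩ *
        (initialCycle n a * finalCycle n (a - 2)) := by
  ext v
  have hv := v.2
  simp only [Perm.mul_apply, val_swap_apply]
  have h1 := val_initialCycle_apply han.le v
  have h2 := val_finalCycle_apply (k := a - 2) (initialCycle n a v)
  have h3 := val_finalCycle_apply (k := a - 2) v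
  have h4 := val_initialCycle_apply han.le (finalCycle n (a - 2) v)
  generalize (finalCycle n (a - 2) (initialCycle n a v) : ℕ) = w at *
  generalize (initialCycle n a (finalCycle n (a - 2) v) : ℕ) = w' at *
  generalize (initialCycle n a v : ℕ) = u at *
  generalize (finalCycle n (a - 2) v : ℕ) = u' at *
  split_ifs at h1 <;> split_ifs at h3 <;> try omega
  all_goals split_ifs at h2 <;> try omega
  all_goals split_ifs at h4 <;> try omega
  all_goals split_ifs <;> omega

lemma wordLe_double_transposition {n a : ℕ} (ha : 3 ≤ a) (han : a < n) :
    WordLe (puzzleGenerators n a) 4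
      (swap (⟨a - 2, by omega⟩ : Fin n) ⟨a - 1, by omega⟩ * swap ⟨0, by omega⟩ ⟨a, han⟩) := by
  rw [← mul_inv_eq_iff_eq_mul.2 (swap_mul_swap_mul_eq_finalCycle_mul_initialCycle ha han)]
  exact ((wordLe_finalCycle n a).mul (wordLe_initialCycle n a)).mul
    ((wordLe_initialCycle n a).mul (wordLe_finalCycle n a)).inv

lemma initialCycle_apply_eq {n a : ℕ} (han : a ≤ n) (v w : Fin n)
    (h : (w : ℕ) = if (v : ℕ) + 1 < a then (v : ℕ) + 1 else if (v : ℕ) < a then 0 else v) :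
    initialCycle n a v = w :=
  Fin.ext ((val_initialCycle_apply han v).trans h.symm)

lemma wordLe_threeCycle_of_six_le {n a : ℕ} (ha : 6 ≤ a) (han : a < n) :
    WordLe (puzzleGenerators n a) 96
      (swap (⟨a - 1, by omega⟩ : Fin n) ⟨1, by omega⟩ * swap ⟨a - 1, by omega⟩ ⟨2, by omega⟩) := by
  have hα := wordLe_initialCycle n a
  have hy : initialCycle n a ⟨a, han⟩ = ⟨a, han⟩ := by
    apply initialCycle_apply_eq han.le
    dsimp only
    split_ifs <;> omega
  have hy' : (initialCycle n a)⁻¹ ⟨a, han⟩ = ⟨a, han⟩ := by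
    rw [Perm.inv_eq_iff_eq, hy]
  have step : ∀ i (hi : i + 1 < a), initialCycle n a ⟨i, by omega⟩ = ⟨i + 1, by omega⟩ := by
    intro i hi
    apply initialCycle_apply_eq han.le
    rw [if_pos hi]
  have step' : ∀ i (hi : i + 1 < a), (initialCycle n a)⁻¹ ⟨i + 1, by omega⟩ = ⟨i, by omega⟩ :=
    fun i hi => by rw [Perm.inv_eq_iff_eq, step i hi]
  have last : initialCycle n a ⟨a - 1, by omega⟩ = ⟨0, by omega⟩ := by
    apply initialCycle_apply_eq han.le
    dsimp only
    split_ifs <;> omega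
  have last' : (initialCycle n a)⁻¹ ⟨0, by omega⟩ = ⟨a - 1, by omega⟩ := by
    rw [Perm.inv_eq_iff_eq, last]
  obtain ⟨k, rfl⟩ : ∃ k, a = k + 6 := ⟨a - 6, by omega⟩
  have d0 := wordLe_double_transposition (by omega) han
  simp only [show k + 6 - 2 = k + 3 + 1 by omega, show k + 6 - 1 = k + 4 + 1 by omega] at *
  have d1 := hα.conj_double hy d0
  rw [step _ (by omega), last, step _ (by omega)] at d1
  have d2 := hα.conj_double hy d1
  rw [last, step 0 (by omega), step (0 + 1) (by omega)] at d2
  have e1 := hα.inv.conj_double hy' d0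
  rw [step' _ (by omega), step' (k + 4) (by omega), last'] at e1
  have e2 := hα.inv.conj_double hy' e1
  rw [step' (k + 2) (by omega), step' (k + 3) (by omega), step' (k + 4) (by omega)] at e2
  -- Conjugation by powers of α keeps y = a and slides the other three points along the first cycle.
  -- Each pair used here covers a - 3, a - 2, a - 1, 0, 1, 2 or a - 4, a - 3, a - 2, a - 1, 0, 1
  -- once; this is where a ≥ 6 is needed.
  have t1 := WordLe.swap_mul_swap_of_double (by simp; try omega) e1 d2
  have t2 := WordLe.swap_mul_swap_of_double (by simp; try omega) e2 d1
  -- The 3-cycles on {a - 1, 2, y} and {a - 2, 1, y} share only y. The resulting length is 84; 96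
  -- leaves slack.
  have t := WordLe.swap_mul_swap_of_swap_mul_swap (by simp) t1 t2
  exact t.mono (by norm_num)

end ThreeCycles
-- Short 3-cycles in the small cases
section SmallCases

open Equiv

/-- For b = 2, β is the transposition (q z) itself, and its conjugate by the rotation is (q c(z)).
-/
lemma wordLe_threeCycle_self {n : ℕ} (hn : 2 ≤ n) :
    WordLe (puzzleGenerators n n) 6 (swap (⟨n - 1, by omega⟩ : Fin n) ⟨n - 2, by omega⟩ *
      swap ⟨n - 1, by omega⟩ (rotation n n ⟨n - 2, by omega⟩)) := by
  have e : finalCycle n (n - 2) = swap ⟨n - 1, by omega⟩ ⟨n - 2, by omega⟩ := by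
    ext v
    rw [val_finalCycle_apply, val_swap_apply]
    have := v.2
    dsimp only
    split_ifs <;> omega
  have h1 := wordLe_finalCycle n n
  have h2 := h1.conj (wordLe_rotation n n)
  rw [e] at h1 h2
  rw [← swap_apply_apply, rotation_apply_self hn le_rfl] at h2
  exact h1.mul h2

lemma wordLe_threeCycle_succ {a : ℕ} (ha : 2 ≤ a) :
    WordLe (puzzleGenerators (a + 1) a) 1
      (swap (⟨a - 1, by omega⟩ : Fin (a + 1)) ⟨a - 2, by omega⟩ *
        swap ⟨a - 1, by omega⟩ (rotation (a + 1) a ⟨a - 2, by omega⟩)) := by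
  have hr : rotation (a + 1) a ⟨a - 2, by omega⟩ = ⟨a, by omega⟩ := by
    apply rotation_apply_eq ha (by omega)
    dsimp only
    split_ifs <;> omega
  rw [hr]
  convert! wordLe_finalCycle (a + 1) a using 1
  ext v
  rw [Perm.mul_apply, val_swap_apply, val_swap_apply, val_finalCycle_apply]
  have := v.2
  dsimp only
  split_ifs <;> omega

set_option maxRecDepth 20000 in
lemma wordLe_threeCycle_five_four :
    WordLe (puzzleGenerators 7 5) 8 (swap 4 6 * swap 4 (rotation 7 5 6)) := by
  -- Here αβ = (0 1 2 3)(4 5 6), so its fourth power is (4 5 6).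
  have e : swap 4 6 * swap 4 (rotation 7 5 6) = (initialCycle 7 5 * finalCycle 7 (5 - 2)) ^ 4 := by
    decide
  rw [e]
  exact ((wordLe_initialCycle 7 5).mul (wordLe_finalCycle 7 5)).pow 4

set_option maxRecDepth 20000 in
lemma wordLe_threeCycle_five_five :
    WordLe (puzzleGenerators 8 5) 10 (swap 4 2 * swap 4 (rotation 8 5 2)) := by
  -- With γ = β⁻¹αβ = (0 1 2 7 3), the word is α²γ²α⁻¹γ⁻¹.
  have e : swap 4 2 * swap 4 (rotation 8 5 2) = (initialCycle 8 5) ^ 2 * (finalCycle 8 (5 - 2))⁻¹ *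
      (initialCycle 8 5) ^ 2 * finalCycle 8 (5 - 2) * (initialCycle 8 5)⁻¹ *
      (finalCycle 8 (5 - 2))⁻¹ * (initialCycle 8 5)⁻¹ * finalCycle 8 (5 - 2) := by
    decide
  have hA := wordLe_initialCycle 8 5
  have hB := wordLe_finalCycle 8 5
  rw [e]
  exact (((((((hA.pow 2).mul hB.inv).mul (hA.pow 2)).mul hB).mul hA.inv).mul hB.inv).mul
    hA.inv).mul hB

end SmallCases

/-! ### The exceptional case a = b = 4 -/

section FourFour

open Equiv

/-- The five perfect matchings of a 1-factorization of the complete graph on `Fin 6`, as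
fixed-point-free involutions. -/
def matching : Fin 5 → Perm (Fin 6) :=
  ![swap 0 1 * swap 2 4 * swap 3 5, swap 0 2 * swap 1 3 * swap 4 5,
    swap 0 3 * swap 1 4 * swap 2 5, swap 0 4 * swap 1 5 * swap 2 3,
    swap 0 5 * swap 1 2 * swap 3 4]

lemma matching_injective : Function.Injective matching := by decide

/-- The pairs of permutations that act compatibly on the vertices and on the matchings. -/
def matchingStabilizer : Subgroup (Perm (Fin 6) × Perm (Fin 5)) where
  carrier := {x | ∀ i, x.1 * matching i = matching (x.2 i) * x.1}
  one_mem' i := by simp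
  mul_mem' {x y} hx hy i := by
    simp only [Prod.fst_mul, Prod.snd_mul, Perm.mul_apply]
    rw [mul_assoc, hy, ← mul_assoc, hx, mul_assoc]
  inv_mem' {x} hx i := by
    have h := hx (x.2⁻¹ i)
    rw [← Perm.mul_apply, mul_inv_cancel, Perm.one_apply] at h
    rw [Prod.fst_inv, Prod.snd_inv, inv_mul_eq_iff_eq_mul, ← mul_assoc, h, mul_inv_cancel_right]

/-- The relations between images of the vertex 0 under the matchings single out 0, so g fixes it;
every other vertex is matched to 0 by some matching and is then fixed too. -/
lemma eq_one_of_commute_matching {g : Perm (Fin 6)} (hg : ∀ i, g * matching i = matching i * g) :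
    g = 1 := by
  have h1 : ∀ i x, g (matching i x) = matching i (g x) := fun i x =>
    DFunLike.congr_fun (hg i) x
  have h0 : g 0 = 0 := by
    have key : ∀ x : Fin 6, (∀ i j k, matching j (matching i 0) = matching k 0 →
        matching j (matching i x) = matching k x) → x = 0 := by decide
    refine key _ fun i j k h => ?_
    rw [← h1, ← h1, ← h1, h]
  have hcov : ∀ x : Fin 6, x = 0 ∨ ∃ i, matching i 0 = x := by decide
  ext x
  obtain rfl | ⟨i, rfl⟩ := hcov x
  · rw [h0]; rfl
  · rw [h1, h0]; rfl

lemma matchingStabilizer_fst_injective {x : Perm (Fin 6) × Perm (Fin 5)}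
    (hx : x ∈ matchingStabilizer) (h : x.1 = 1) : x = 1 := by
  refine Prod.ext h (Equiv.ext fun i => matching_injective ?_)
  have := hx i
  rw [h, one_mul, mul_one] at this
  exact this.symm

lemma matchingStabilizer_snd_injective {x : Perm (Fin 6) × Perm (Fin 5)}
    (hx : x ∈ matchingStabilizer) (h : x.2 = 1) : x = 1 := by
  refine Prod.ext (eq_one_of_commute_matching fun i => ?_) h
  have := hx i
  rwa [h] at this

/-- If a homomorphism is injective on `closure S`, then it identifies `closure S` with the subgroup
generated by the image of `S`. -/
noncomputable def closureEquivOfInjective {G H : Type*} [Group G] [Group H] (f : G →* H) (S : Set G)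
    (hf : ∀ x ∈ Subgroup.closure S, f x = 1 → x = 1) :
    Subgroup.closure S ≃* Subgroup.closure (f '' S) :=
  ((f.comp (Subgroup.closure S).subtype).ofInjective
    ((injective_iff_map_eq_one _).2 fun x hx => Subtype.ext (hf x x.2 hx))).trans
    (MulEquiv.subgroupCongr (by
      rw [MonoidHom.range_comp, Subgroup.range_subtype, MonoidHom.map_closure]))

/-- The permutations of the matchings induced by the two cycles generate `Perm (Fin 5)`. -/
lemma closure_matching_action_eq_top :
    Subgroup.closure {c[(0 : Fin 5), 4, 3, 2], c[1, 2, 3, 4]} = ⊤ := by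
  set A : Perm (Fin 5) := c[(0 : Fin 5), 4, 3, 2]
  set B : Perm (Fin 5) := c[(1 : Fin 5), 2, 3, 4]
  have hA : A ∈ Subgroup.closure {A, B} := Subgroup.subset_closure (by simp)
  have hB : B ∈ Subgroup.closure {A, B} := Subgroup.subset_closure (by simp)
  -- A 5-cycle and a transposition generate S₅, as 5 is prime.
  have e1 : A * B⁻¹ = [(0 : Fin 5), 4, 2, 1, 3].formPerm := by decide
  have e2 : A * A * B * A⁻¹ * B = swap 1 2 := by decide
  have hc : (A * B⁻¹).IsCycle := by
    rw [e1]
    exact List.isCycle_formPerm (by decide) (by decide)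
  have hs : (A * B⁻¹).support = Finset.univ := by decide
  rw [eq_top_iff, ← Perm.closure_prime_cycle_swap (by simpa using Nat.prime_five) hc hs
    ⟨1, 2, by decide, e2⟩, Subgroup.closure_le]
  rintro x (rfl | rfl)
  · exact mul_mem hA (inv_mem hB)
  · exact mul_mem (mul_mem (mul_mem (mul_mem hA hA) hB) (inv_mem hA)) hB

theorem nonempty_closure_puzzleGenerators_mulEquiv :
    Nonempty (Subgroup.closure (puzzleGenerators 6 4) ≃* Perm (Fin 5)) := by
  -- Each cycle is paired with the permutation it induces on the matchings. Both projections are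
  -- injective on the group generated by these pairs, which links the puzzle group to S₅.
  let T : Set (Perm (Fin 6) × Perm (Fin 5)) :=
    {(initialCycle 6 4, c[0, 4, 3, 2]), (finalCycle 6 (4 - 2), c[1, 2, 3, 4])}
  have hT : Subgroup.closure T ≤ matchingStabilizer := by
    rw [Subgroup.closure_le]
    rintro x (rfl | rfl)
    · change ∀ i, _
      decide
    · change ∀ i, _
      decide
  have e1 := closureEquivOfInjective (MonoidHom.fst _ _) T
    fun x hx h => matchingStabilizer_fst_injective (hT hx) h
  have e2 := closureEquivOfInjective (MonoidHom.snd _ _) T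
    fun x hx h => matchingStabilizer_snd_injective (hT hx) h
  rw [Set.image_pair] at e1 e2
  refine ⟨e1.symm.trans (e2.trans ((MulEquiv.subgroupCongr ?_).trans Subgroup.topEquiv))⟩
  exact closure_matching_action_eq_top

end FourFour

/-! ### Quadratic bounds and identification of the groups -/

section Main

open Equiv

lemma exists_wordLe_threeCycle {n a b : ℕ} (hb : 2 ≤ b) (hba : b ≤ a) (hab : a + b = n + 2)
    (h44 : ¬ (a = 4 ∧ b = 4)) :
    ∃ q z : Fin n, (q : ℕ) = a - 1 ∧ z ≠ q ∧
      WordLe (puzzleGenerators n a) 96 (swap q z * swap q (rotation n a z)) := by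
  obtain rfl | hb2 := hb.eq_or_lt
  · obtain rfl : a = n := by omega
    exact ⟨⟨a - 1, by omega⟩, ⟨a - 2, by omega⟩, rfl, by simp only [ne_eq, Fin.mk.injEq]; omega,
      (wordLe_threeCycle_self hba).mono (by norm_num)⟩
  obtain rfl | hb3 := (Nat.succ_le_of_lt hb2).eq_or_lt
  · obtain rfl : n = a + 1 := by omega
    exact ⟨⟨a - 1, by omega⟩, ⟨a - 2, by omega⟩, rfl, by simp only [ne_eq, Fin.mk.injEq]; omega,
      (wordLe_threeCycle_succ (by omega)).mono (by norm_num)⟩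
  by_cases ha : 6 ≤ a
  · refine ⟨⟨a - 1, by omega⟩, ⟨1, by omega⟩, rfl, by simp only [ne_eq, Fin.mk.injEq]; omega, ?_⟩
    have hr : rotation n a ⟨1, by omega⟩ = ⟨2, by omega⟩ := by
      apply rotation_apply_eq (by omega) (by omega)
      dsimp only
      split_ifs <;> omega
    rw [hr]
    exact wordLe_threeCycle_of_six_le ha (by omega)
  -- Now 4 ≤ b ≤ a ≤ 5, and a = 4 would force the excluded case.
  obtain rfl : a = 5 := by omega
  obtain rfl | rfl : b = 4 ∨ b = 5 := by omega
  · obtain rfl : n = 7 := by omega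
    exact ⟨4, 6, rfl, by decide, wordLe_threeCycle_five_four.mono (by norm_num)⟩
  · obtain rfl : n = 8 := by omega
    exact ⟨4, 2, rfl, by decide, wordLe_threeCycle_five_five.mono (by norm_num)⟩

theorem wordLe_quadratic_of_sign_eq_one {n a b : ℕ} (ha : 2 ≤ a) (hb : 2 ≤ b) (hab : a + b = n + 2)
    (h44 : ¬ (a = 4 ∧ b = 4)) {π : Perm (Fin n)} (hπ : Perm.sign π = 1) :
    WordLe (puzzleGenerators n a) (600 * n ^ 2) π := by
  wlog hba : b ≤ a generalizing a b π
  · have h := this hb ha (by omega) (by tauto)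
      (π := (Fin.revPerm : Perm (Fin n))⁻¹ * π * Fin.revPerm) (by
        rw [map_mul, map_mul, Perm.sign_inv, mul_right_comm, Int.units_mul_self, one_mul, hπ])
      (by omega)
    have h' := h.revPerm_conj hb ha (by omega)
    simpa [mul_assoc] using h'
  obtain ⟨q, z, hq, hz, hT⟩ := exists_wordLe_threeCycle hb hba hab h44
  exact wordLe_of_sign_eq_one_of_swap_mul_swap ha (by omega) hq hz hT hπ

lemma exists_mem_puzzleGenerators_sign_eq_neg_one {n a b : ℕ} (ha : 2 ≤ a) (hb : 2 ≤ b)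
    (hab : a + b = n + 2) (hodd : ¬ (Odd a ∧ Odd b)) :
    ∃ g ∈ puzzleGenerators n a, Perm.sign g = -1 := by
  by_cases hae : Even a
  · exact ⟨_, Set.mem_insert _ _, by rw [sign_initialCycle ha (by omega), hae.neg_one_pow]⟩
  · have hbe : Even b := by
      rw [← Nat.not_odd_iff_even]
      exact fun h => hodd ⟨Nat.not_even_iff_odd.1 hae, h⟩
    refine ⟨_, Set.mem_insert_of_mem _ rfl, ?_⟩
    rw [sign_finalCycle (by omega), show n - (a - 2) = b by omega, hbe.neg_one_pow]

theorem wordLe_quadratic {n a b : ℕ} (ha : 2 ≤ a) (hb : 2 ≤ b) (hab : a + b = n + 2)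
    (h44 : ¬ (a = 4 ∧ b = 4)) (hodd : ¬ (Odd a ∧ Odd b)) (π : Perm (Fin n)) :
    WordLe (puzzleGenerators n a) (601 * n ^ 2) π := by
  have hn : 1 ≤ n ^ 2 := Nat.one_le_pow _ _ (by omega)
  rcases Int.units_eq_one_or (Perm.sign π) with h | h
  · exact (wordLe_quadratic_of_sign_eq_one ha hb hab h44 h).mono (by omega)
  · obtain ⟨g, hg, hs⟩ := exists_mem_puzzleGenerators_sign_eq_neg_one ha hb hab hodd
    -- An odd generator g makes πg even at the cost of one more letter, hence 601 in place of 600 =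
    -- 6(96 + 4).
    have h1 := wordLe_quadratic_of_sign_eq_one ha hb hab h44 (π := π * g) (by
      rw [map_mul, h, hs, neg_mul_neg, one_mul])
    have h2 := h1.mul (WordLe.of_mem hg).inv
    rw [mul_inv_cancel_right] at h2
    exact h2.mono (by omega)

theorem closure_puzzleGenerators_eq_alternatingGroup {n a b : ℕ} (ha : 2 ≤ a) (hb : 2 ≤ b)
    (hab : a + b = n + 2) (hao : Odd a) (hbo : Odd b) :
    Subgroup.closure (puzzleGenerators n a) = alternatingGroup (Fin n) := by
  refine le_antisymm ?_ fun π hπ => ?_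
  · rw [Subgroup.closure_le]
    rintro g (rfl | rfl)
    · rw [SetLike.mem_coe, Perm.mem_alternatingGroup, sign_initialCycle ha (by omega),
        hao.neg_one_pow, neg_neg]
    · rw [SetLike.mem_coe, Perm.mem_alternatingGroup, sign_finalCycle (by omega),
        show n - (a - 2) = b by omega, hbo.neg_one_pow, neg_neg]
  · refine (wordLe_quadratic_of_sign_eq_one ha hb hab ?_ (Perm.mem_alternatingGroup.1 hπ)).mem_closure
    rintro ⟨rfl, -⟩
    exact absurd hao (by decide)

end Main

end CyclicShift

theorem theorem2 :
    (∀ a b : ℕ, 2 ≤ a → 2 ≤ b →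
      (a = 4 ∧ b = 4 →
        Nonempty (CyclicShift.configurationGroup (CyclicShift.twoConnectedCycles a b) ≃*
          Equiv.Perm (Fin 5))) ∧
      (Odd a ∧ Odd b →
        CyclicShift.configurationGroup (CyclicShift.twoConnectedCycles a b) =
          alternatingGroup (Fin (a + b - 2))) ∧
      (¬ (a = 4 ∧ b = 4) → ¬ (Odd a ∧ Odd b) →
        CyclicShift.configurationGroup (CyclicShift.twoConnectedCycles a b) = ⊤)) ∧
    (∃ K : ℕ, ∀ a b : ℕ, 2 ≤ a → 2 ≤ b →
      ∀ π ∈ CyclicShift.configurationGroup (CyclicShift.twoConnectedCycles a b),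
        ∃ w : (CyclicShift.tokenShiftingGraph (CyclicShift.twoConnectedCycles a b)).Walk 1 π,
          w.length ≤ K * (a + b - 2) ^ 2) := by
  open CyclicShift in
  have hG : ∀ a b : ℕ, configurationGroup (twoConnectedCycles a b) =
      Subgroup.closure (puzzleGenerators (a + b - 2) a) := fun a b => by
    rw [configurationGroup_eq_closure, formPerm_image_twoConnectedCycles]
  refine ⟨fun a b ha hb => ⟨?_, ?_, ?_⟩, ?_⟩
  · rintro ⟨rfl, rfl⟩
    rw [hG]
    exact nonempty_closure_puzzleGenerators_mulEquiv
  · rintro ⟨hao, hbo⟩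
    rw [hG]
    exact closure_puzzleGenerators_eq_alternatingGroup ha hb (by omega) hao hbo
  · intro h44 hodd
    rw [hG, eq_top_iff]
    exact fun π _ => (wordLe_quadratic ha hb (by omega) h44 hodd π).mem_closure
  -- K bounds the word lengths in the single finite group of the exceptional case.
  · obtain ⟨K, hK⟩ := exists_forall_wordLe (puzzleGenerators 6 4)
    refine ⟨K + 601, fun a b ha hb π hπ => exists_walk_of_wordLe ?_⟩
    rw [hG] at hπ
    rw [formPerm_image_twoConnectedCycles]
    have hn : 1 ≤ (a + b - 2) ^ 2 := Nat.one_le_pow _ _ (by omega)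
    by_cases h44 : a = 4 ∧ b = 4
    · obtain ⟨rfl, rfl⟩ := h44
      exact (hK π hπ).mono (by omega)
    · refine WordLe.mono ?_ (Nat.mul_le_mul_right _ (Nat.le_add_left 601 K))
      by_cases hodd : Odd a ∧ Odd b
      · rw [closure_puzzleGenerators_eq_alternatingGroup ha hb (by omega) hodd.1 hodd.2] at hπ
        exact (wordLe_quadratic_of_sign_eq_one ha hb (by omega) h44
          (Equiv.Perm.mem_alternatingGroup.1 hπ)).mono (Nat.mul_le_mul_right _ (by norm_num))
      · exact wordLe_quadratic ha hb (by omega) h44 hodd π
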